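/- Let $N,k\in\mathbb{N}$ and $q\in(0,1)$. Let $\mathfrak{Y}_N$ be the set of integer vectors $\lambda=(\lambda_1\ge\dots\ge\lambda_N\ge 0)$, and write $|\lambda|=\lambda_1+\dots+\lambda_N$. For $\lambda\in\mathfrak{Y}_N$ let $(\mathbf{W}_N^\lambda,S_N^\lambda)$ be the irreducible representation of the unitary group $\mathbb{U}_N$ with highest weight $\lambda$ (realized as the image of the Young symmetrizer of $\lambda$ in $(\mathbb{C}^N)^{\otimes|\lambda|}$), and let $s_\lambda(U)=\operatorname{Tr}S_N^\lambda(U)$ be its character (the Schur polynomial $s_\lambda$ in the eigenvalues of $U$). For $U\in\mathbb{U}_N$ put $$Z_N=Z_N(U)=\sum_{\lambda\in\mathfrak{Y}_N}q^{|\lambda|}\,|s_\lambda(U)|^2 .$$ For $\lambda^1,\dots,\lambda^k\in\mathfrak{Y}_N$ let $I_N(\lambda^1,\dots,\lambda^k)$ be the dimension of the space of $\mathbb{U}_N$-invariants in the tensor product $$\operatorname{End}\mathbf{W}_N^{\lambda^1}\otimes\dots\otimes\operatorname{End}\mathbf{W}_N^{\lambda^k}$$ of adjoint representations, where $U\in\mathbb{U}_N$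 acts on $A\in\operatorname{End}\mathbf{W}_N^{\lambda}$ by $A\mapsto S_N^\lambda(U)\,A\,S_N^\lambda(U^{-1})$. Then the series $Z_N(U)$ converges for every $U\in\mathbb{U}_N$, and, with $\mathbb{E}$ denoting expectation over $U$ distributed according to the Haar probability measure on $\mathbb{U}_N$, the moment $\mathbb{E}Z_N^k$ is finite and $$\mathbb{E}Z_N^k=\sum_{\lambda^1,\dots,\lambda^k\in\mathfrak{Y}_N}q^{|\lambda^1|+\dots+|\lambda^k|}\,I_N(\lambda^1,\dots,\lambda^k),$$ the series on the right being convergent. -/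

import Mathlib

open MeasureTheory
open scoped TensorProduct

namespace SchurCUE

noncomputable section

/-- The compact Lie group `U(N)` of unitary `N × N` complex matrices. -/
abbrev UN (N : ℕ) : Type := Matrix.unitaryGroup (Fin N) ℂ

/-- The Borel `σ`-algebra on `U(N)`. -/
instance instMeasurableSpaceUN (N : ℕ) : MeasurableSpace (UN N) := borel (UN N)

instance instBorelSpaceUN (N : ℕ) : BorelSpace (UN N) := ⟨rfl⟩

instance instCompactSpaceUN (N : ℕ) : CompactSpace (UN N) := by
  have hc : IsClosed (Matrix.unitaryGroup (Fin N) ℂ : Set (Matrix (Fin N) (Fin N) ℂ)) :=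
    isClosed_unitary
  have hK : IsCompact (Set.pi Set.univ fun _ : Fin N => Set.pi Set.univ fun _ : Fin N =>
      Metric.closedBall (0 : ℂ) 1) :=
    isCompact_univ_pi fun _ => isCompact_univ_pi fun _ => isCompact_closedBall _ _
  refine isCompact_iff_compactSpace.mp (IsCompact.of_isClosed_subset hK hc ?_)
  intro U hU i _ j _
  simpa using entry_norm_bound_of_unitary hU i j

/-- The Haar probability measure on `U(N)`: the Haar measure normalized to give `U(N)` mass `1`. -/
def haarU (N : ℕ) : Measure (UN N) := Measure.haarMeasure ⊤

/-- `𝔜_N`: vectors `λ = (λ₁ ≥ … ≥ λ_N)` of nonnegative integers. -/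
abbrev Partn (N : ℕ) : Type := {l : Fin N → ℕ // Antitone l}

/-- `|λ| = λ₁ + … + λ_N`. -/
def Partn.size {N : ℕ} (l : Partn N) : ℕ := ∑ i, l.1 i

/-- The cells of the Young diagram of `λ`: the cell `⟨i, j⟩` is in row `i` and column `j`. -/
abbrev Cell {N : ℕ} (l : Partn N) : Type := Σ i : Fin N, Fin (l.1 i)

/-- The tensor power `(ℂ^N)^{⊗|λ|}`, its factors indexed by the cells of `λ`. -/
abbrev TensorPow {N : ℕ} (l : Partn N) : Type := ⨂[ℂ] _ : Cell l, (Fin N → ℂ)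

/-- The diagonal action `U ⊗ ⋯ ⊗ U` of `U(N)` on `(ℂ^N)^{⊗|λ|}`. -/
def tensorRep {N : ℕ} (l : Partn N) : Representation ℂ (UN N) (TensorPow l) where
  toFun U := PiTensorProduct.map fun _ => Matrix.toLin' (U : Matrix (Fin N) (Fin N) ℂ)
  map_one' := by
    simp only [OneMemClass.coe_one, Matrix.toLin'_one]
    exact PiTensorProduct.map_id
  map_mul' U V := by
    simp only [MulMemClass.coe_mul, Matrix.toLin'_mul]
    exact PiTensorProduct.map_comp _ _

/-- A permutation of the cells acting on `(ℂ^N)^{⊗|λ|}` by permuting the tensor factors. -/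
def permAct {N : ℕ} (l : Partn N) (σ : Equiv.Perm (Cell l)) : TensorPow l →ₗ[ℂ] TensorPow l :=
  (PiTensorProduct.reindex ℂ (fun _ : Cell l => (Fin N → ℂ)) σ).toLinearMap

/-- Permutations of the cells that preserve every row. -/
def rowPerms {N : ℕ} (l : Partn N) : Finset (Equiv.Perm (Cell l)) :=
  Finset.univ.filter fun σ => ∀ c, (σ c).1 = c.1

/-- Permutations of the cells that preserve every column. -/
def colPerms {N : ℕ} (l : Partn N) : Finset (Equiv.Perm (Cell l)) :=
  Finset.univ.filter fun σ => ∀ c, ((σ c).2 : ℕ) = (c.2 : ℕ)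

/-- The Young symmetrizer `c_λ = (∑_{σ ∈ R_λ} σ) (∑_{τ ∈ C_λ} sgn(τ) τ)` on `(ℂ^N)^{⊗|λ|}`. -/
def youngSymmetrizer {N : ℕ} (l : Partn N) : TensorPow l →ₗ[ℂ] TensorPow l :=
  (∑ σ ∈ rowPerms l, permAct l σ) ∘ₗ
    (∑ τ ∈ colPerms l, ((Equiv.Perm.sign τ : ℤ) : ℂ) • permAct l τ)

theorem permAct_tensorRep {N : ℕ} (l : Partn N) (σ : Equiv.Perm (Cell l)) (U : UN N)
    (x : TensorPow l) : permAct l σ (tensorRep l U x) = tensorRep l U (permAct l σ x) :=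
  (PiTensorProduct.map_reindex
    (fun _ : Cell l => Matrix.toLin' (U : Matrix (Fin N) (Fin N) ℂ)) σ x).symm

theorem youngSymmetrizer_tensorRep {N : ℕ} (l : Partn N) (U : UN N) (x : TensorPow l) :
    youngSymmetrizer l (tensorRep l U x) = tensorRep l U (youngSymmetrizer l x) := by
  simp only [youngSymmetrizer, LinearMap.comp_apply, LinearMap.sum_apply, LinearMap.smul_apply,
    permAct_tensorRep, map_sum, map_smul]

/-- The image of the Young symmetrizer in `(ℂ^N)^{⊗|λ|}`. -/
def youngImage {N : ℕ} (l : Partn N) : Submodule ℂ (TensorPow l) :=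
  LinearMap.range (youngSymmetrizer l)

/-- Weyl's construction of the irreducible representation `W_N^λ` of `U(N)` with highest weight
`λ`: the image of the Young symmetrizer in `(ℂ^N)^{⊗|λ|}`. -/
def Irrep {N : ℕ} (l : Partn N) : Type := youngImage l

instance instAddCommGroupIrrep {N : ℕ} (l : Partn N) : AddCommGroup (Irrep l) :=
  inferInstanceAs (AddCommGroup (youngImage l))

instance instModuleIrrep {N : ℕ} (l : Partn N) : Module ℂ (Irrep l) :=
  inferInstanceAs (Module ℂ (youngImage l))

instance instFiniteIrrep {N : ℕ} (l : Partn N) : Module.Finite ℂ (Irrep l) :=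
  inferInstanceAs (Module.Finite ℂ (youngImage l))

/-- The action `S_N^λ` of `U(N)` on `W_N^λ`. -/
def irrep {N : ℕ} (l : Partn N) : Representation ℂ (UN N) (Irrep l) :=
  (tensorRep l).subrepresentation (youngImage l) (by
    rintro U _ ⟨y, rfl⟩
    exact ⟨tensorRep l U y, youngSymmetrizer_tensorRep l U y⟩)

/-- The character `s_λ(U) = Tr S_N^λ(U)`. -/
def schurChar {N : ℕ} (l : Partn N) (U : UN N) : ℂ :=
  LinearMap.trace ℂ (Irrep l) (irrep l U)

/-- The term `q^{|λ|} |s_λ(U)|²` of the partition function. -/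
def partitionTerm {N : ℕ} (q : ℝ) (U : UN N) (l : Partn N) : ℝ :=
  q ^ l.size * ‖schurChar l U‖ ^ 2

/-- The partition function `Z_N = ∑_{λ ∈ 𝔜_N} q^{|λ|} |s_λ(U)|²`. -/
def partitionFn {N : ℕ} (q : ℝ) (U : UN N) : ℝ := ∑' l : Partn N, partitionTerm q U l

/-- The adjoint representation of `U(N)` on `End W_N^λ`: `U` sends `A` to
`S_N^λ(U) A S_N^λ(U⁻¹)`. -/
def adjointRep {N : ℕ} (l : Partn N) :
    Representation ℂ (UN N) (Irrep l →ₗ[ℂ] Irrep l) :=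
  (irrep l).linHom (irrep l)

/-- The space `End W_N^{λ¹} ⊗ ⋯ ⊗ End W_N^{λᵏ}`. -/
abbrev AdjointTensor {N k : ℕ} (L : Fin k → Partn N) : Type :=
  ⨂[ℂ] i : Fin k, (Irrep (L i) →ₗ[ℂ] Irrep (L i))

/-- The tensor product of the adjoint representations on `End W_N^{λ¹} ⊗ ⋯ ⊗ End W_N^{λᵏ}`. -/
def adjointTensorRep {N k : ℕ} (L : Fin k → Partn N) :
    Representation ℂ (UN N) (AdjointTensor L) where
  toFun U := PiTensorProduct.map fun i => adjointRep (L i) U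
  map_one' := by
    simp only [map_one]
    exact PiTensorProduct.map_id
  map_mul' U V := by
    simp only [map_mul]
    exact PiTensorProduct.map_comp _ _

/-- `I_N(λ¹, …, λᵏ)`: the dimension of the space of `U(N)`-invariants in
`End W_N^{λ¹} ⊗ ⋯ ⊗ End W_N^{λᵏ}`. -/
def invDim {N k : ℕ} (L : Fin k → Partn N) : ℕ :=
  Module.finrank ℂ (Representation.invariants (k := ℂ) (G := UN N) (V := AdjointTensor L)
    (adjointTensorRep L))

end

end SchurCUE

/-! Expanding $Z_N^k$ gives a sum over $k$-tuples of the products $\prod_i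
q^{|\lambda^i|}|s_{\lambda^i}(U)|^2$. Since $W_N^\lambda$ is unitarizable,
$s_\lambda(U^{-1})=\overline{s_\lambda(U)}$, so $|s_\lambda|^2$ is the character of the adjoint
representation and $\prod_i|s_{\lambda^i}|^2$ that of the tensor product
(`character_adjointTensorRep`). Its Haar mean is the dimension of the invariants
(`WeaklyContinuous.integral_character`).

Convergence and the exchange of sum and integral rest on a bound uniform in $U$:
$|s_\lambda(U)|\le\dim W_N^\lambda\le(|\lambda|+1)^{N^2}$ (`finrank_irrep_le`). For fixed $N$ this
is polynomial in $|\lambda|$, and the weights $q^{|\lambda|}$ beat it. -/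

open MeasureTheory Module
open scoped TensorProduct ComplexConjugate Matrix

namespace SchurCUE

/-! ### Unitarity, continuity and averaging of representations -/

section Representations

variable {G V : Type*} [Group G] [AddCommGroup V] [Module ℂ V]

/-- All matrix coefficients of `ρ` are continuous. -/
def WeaklyContinuous [TopologicalSpace G] (ρ : Representation ℂ G V) : Prop :=
  ∀ (φ : Dual ℂ V) (v : V), Continuous fun g => φ (ρ g v)

/-- In a suitable basis, `ρ` acts by unitary matrices. -/
def IsUnitarizable (ρ : Representation ℂ G V) : Prop :=
  ∃ (n : ℕ) (b : Basis (Fin n) ℂ V), ∀ g,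
    LinearMap.toMatrix b b (ρ g⁻¹) = (LinearMap.toMatrix b b (ρ g)).conjTranspose

theorem IsUnitarizable.character_inv {ρ : Representation ℂ G V} (h : IsUnitarizable ρ) (g : G) :
    ρ.character g⁻¹ = conj (ρ.character g) := by
  obtain ⟨n, b, hb⟩ := h
  simp only [Representation.character, LinearMap.trace_eq_matrix_trace ℂ b, hb,
    Matrix.trace_conjTranspose]
  rfl

theorem IsUnitarizable.norm_character_le {ρ : Representation ℂ G V} (h : IsUnitarizable ρ)
    (g : G) : ‖ρ.character g‖ ≤ finrank ℂ V := by
  obtain ⟨n, b, hb⟩ := h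
  have hU : LinearMap.toMatrix b b (ρ g) ∈ Matrix.unitaryGroup (Fin n) ℂ := by
    rw [Matrix.mem_unitaryGroup_iff', Matrix.star_eq_conjTranspose, ← hb,
      ← LinearMap.toMatrix_mul, ← map_mul]
    simp
  rw [Representation.character, LinearMap.trace_eq_matrix_trace ℂ b, Matrix.trace,
    finrank_eq_card_basis b]
  refine (norm_sum_le _ _).trans ((Finset.sum_le_sum fun i _ =>
    entry_norm_bound_of_unitary hU i i).trans ?_)
  simp

/-- Declare `B` orthonormal; then `ρ g⁻¹` is the adjoint of `ρ g`. This survives restriction to `W`,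
where any orthonormal basis for the induced inner product will do. -/
theorem IsUnitarizable.subrepresentation {ι : Type*} [Fintype ι] [DecidableEq ι]
    (B : Basis ι ℂ V) (ρ : Representation ℂ G V)
    (hB : ∀ g, LinearMap.toMatrix B B (ρ g⁻¹) = (LinearMap.toMatrix B B (ρ g)).conjTranspose)
    (W : Submodule ℂ V) (hW : ∀ g, W ≤ W.comap (ρ g)) :
    IsUnitarizable (ρ.subrepresentation W hW) := by
  let e : V ≃ₗ[ℂ] EuclideanSpace ℂ ι := B.equivFun ≪≫ₗ (WithLp.linearEquiv 2 ℂ (ι → ℂ)).symm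
  have he : ∀ g x, e (ρ g x) = WithLp.toLp 2 (LinearMap.toMatrix B B (ρ g) *ᵥ ⇑(B.repr x)) := by
    intro g x
    rw [LinearMap.toMatrix_mulVec_repr]
    rfl
  have he' : ∀ x, e x = WithLp.toLp 2 (⇑(B.repr x)) := fun x => rfl
  have hadj : ∀ g x y, inner ℂ (e x) (e (ρ g⁻¹ y)) = inner ℂ (e (ρ g x)) (e y) := by
    intro g x y
    rw [he, he, he' x, he' y, hB, EuclideanSpace.inner_toLp_toLp, EuclideanSpace.inner_toLp_toLp,
      Matrix.star_mulVec, dotProduct_comm, Matrix.dotProduct_mulVec, dotProduct_comm]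
  let E : Submodule ℂ (EuclideanSpace ℂ ι) := W.map e.toLinearMap
  let ob := stdOrthonormalBasis ℂ E
  let f : W ≃ₗ[ℂ] E := e.submoduleMap W
  let b := ob.toBasis.map f.symm
  have hent : ∀ g i j, LinearMap.toMatrix b b (ρ.subrepresentation W hW g) i j =
      inner ℂ (e (b i : V)) (e (ρ g (b j : V))) := by
    intro g i j
    rw [LinearMap.toMatrix_apply]
    change ob.repr (f (ρ.subrepresentation W hW g (b j))) i = _
    rw [OrthonormalBasis.repr_apply_apply, Submodule.coe_inner]
    congr 1
    change _ = (f (b i) : EuclideanSpace ℂ ι)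
    simp [b]
  refine ⟨_, b, fun g => ?_⟩
  ext i j
  rw [Matrix.conjTranspose_apply, hent, hent, hadj]
  exact (inner_conj_symm _ _).symm

theorem WeaklyContinuous.subrepresentation [TopologicalSpace G] {ρ : Representation ℂ G V}
    (hρ : WeaklyContinuous ρ) (W : Submodule ℂ V) (hW : ∀ g, W ≤ W.comap (ρ g)) :
    WeaklyContinuous (ρ.subrepresentation W hW) := by
  intro φ v
  obtain ⟨ψ, hψ⟩ := φ.exists_extend
  subst hψ
  exact hρ ψ v

theorem WeaklyContinuous.linHom [TopologicalSpace G] [ContinuousInv G] [FiniteDimensional ℂ V]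
    {ρ : Representation ℂ G V} (hρ : WeaklyContinuous ρ) : WeaklyContinuous (ρ.linHom ρ) := by
  intro φ A
  let b := finBasis ℂ V
  -- Each coefficient of $A\mapsto\rho(g)A\rho(g^{-1})$ is a sum of products of a coefficient of
  -- $\rho$ at $g^{-1}$ and one at $g$.
  have hsum : ∀ g, φ (ρ.linHom ρ g A) = ∑ j, ∑ i, b.coord i (ρ g⁻¹ (b j)) *
      φ ((b.coord j).smulRight (ρ g (A (b i)))) := by
    intro g
    have h : ρ.linHom ρ g A = ∑ j, ∑ i, b.coord i (ρ g⁻¹ (b j)) •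
      ((b.coord j).smulRight (ρ g (A (b i)))) := by
      refine b.ext fun m => ?_
      simp only [LinearMap.sum_apply, LinearMap.smul_apply, LinearMap.smulRight_apply,
        Representation.linHom_apply, LinearMap.comp_apply]
      rw [Finset.sum_eq_single m (by intro j _ hj; simp [hj.symm]) (by simp)]
      conv_lhs => rw [← b.sum_repr (ρ g⁻¹ (b m))]
      simp only [map_sum, map_smul, Basis.coord_apply, Basis.repr_self, Finsupp.single_eq_same,
        one_smul]
    rw [h]
    simp
  simp only [hsum]
  refine continuous_finsetSum _ fun j _ => continuous_finsetSum _ fun i _ => ?_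
  exact ((hρ (b.coord i) (b j)).comp continuous_inv).mul
    (hρ (φ ∘ₗ LinearMap.smulRightₗ (b.coord j)) (A (b i)))

theorem continuous_dual_map_piTensorProduct {X : Type*} [TopologicalSpace X] {ι : Type*} [Fintype ι]
    {M : ι → Type*} [∀ i, AddCommGroup (M i)] [∀ i, Module ℂ (M i)]
    [∀ i, FiniteDimensional ℂ (M i)] (T : ∀ i, X → M i →ₗ[ℂ] M i)
    (hT : ∀ i (φ : Dual ℂ (M i)) v, Continuous fun g => φ (T i g v))
    (φ : Dual ℂ (⨂[ℂ] i, M i)) (v : ⨂[ℂ] i, M i) :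
    Continuous fun g => φ (PiTensorProduct.map (fun i => T i g) v) := by
  classical
  induction v using PiTensorProduct.induction_on with
  | smul_tprod r f =>
    simp only [map_smul, PiTensorProduct.map_tprod, smul_eq_mul]
    refine continuous_const.mul ?_
    let B := Basis.piTensorProduct fun i => finBasis ℂ (M i)
    have h : ∀ g, φ (PiTensorProduct.tprod ℂ fun i => T i g (f i)) =
        ∑ p, (∏ i, (finBasis ℂ (M i)).coord (p i) (T i g (f i))) * φ (B p) := by
      intro g
      conv_lhs => rw [← B.sum_repr (PiTensorProduct.tprod ℂ fun i => T i g (f i))]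
      simp [B]
    simp only [h]
    exact continuous_finsetSum _ fun p _ => (continuous_finsetProd _ fun i _ =>
      hT i _ _).mul continuous_const
  | add x y hx hy =>
    simp only [map_add]
    exact hx.add hy

theorem trace_map_piTensorProduct {ι : Type*} [Fintype ι]
    {M : ι → Type*} [∀ i, AddCommGroup (M i)] [∀ i, Module ℂ (M i)]
    [∀ i, FiniteDimensional ℂ (M i)] (T : ∀ i, M i →ₗ[ℂ] M i) :
    LinearMap.trace ℂ (⨂[ℂ] i, M i) (PiTensorProduct.map T) =
      ∏ i, LinearMap.trace ℂ (M i) (T i) := by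
  classical
  simp only [LinearMap.trace_eq_matrix_trace ℂ (finBasis ℂ (M _)), Matrix.trace,
    LinearMap.trace_eq_matrix_trace ℂ (Basis.piTensorProduct fun i => finBasis ℂ (M i)),
    Matrix.diag_apply, LinearMap.toMatrix_apply, Basis.piTensorProduct_apply,
    PiTensorProduct.map_tprod, Basis.piTensorProduct_repr_tprod_apply]
  rw [Finset.prod_univ_sum, Fintype.piFinset_univ]

/-- The mean of the character of a finite-dimensional representation of a compact group is the
dimension of the space of invariants. -/
theorem WeaklyContinuous.integral_character [TopologicalSpace G] [CompactSpace G]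
    [MeasurableSpace G] [BorelSpace G] [ContinuousMul G] (μ : Measure G) [IsProbabilityMeasure μ]
    [μ.IsMulLeftInvariant] [FiniteDimensional ℂ V] {ρ : Representation ℂ G V}
    (hρ : WeaklyContinuous ρ) :
    ∫ g, ρ.character g ∂μ = finrank ℂ ρ.invariants := by
  let b := finBasis ℂ V
  have hint : ∀ (φ : Dual ℂ V) v, Integrable (fun g => φ (ρ g v)) μ := fun φ v =>
    (hρ φ v).integrable_of_hasCompactSupport (HasCompactSupport.of_compactSpace _)
  -- The average $\int\rho(g)\,d\mu$, taken coordinatewise. By left invariance of `μ` it projects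
  -- onto the invariants, so its trace is their dimension.
  let P : V →ₗ[ℂ] V :=
    { toFun := fun v => ∑ i, (∫ g, b.coord i (ρ g v) ∂μ) • b i
      map_add' := fun v w => by
        simp only [map_add, integral_add (hint _ _) (hint _ _), add_smul, Finset.sum_add_distrib]
      map_smul' := fun c v => by
        simp only [map_smul, smul_eq_mul, integral_const_mul, mul_smul, Finset.smul_sum,
          RingHom.id_apply] }
  have hP : ∀ (φ : Dual ℂ V) v, φ (P v) = ∫ g, φ (ρ g v) ∂μ := by
    intro φ v
    have h : ∀ g, φ (ρ g v) = ∑ i, b.coord i (ρ g v) * φ (b i) := by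
      intro g
      conv_lhs => rw [← b.sum_repr (ρ g v)]
      simp only [map_sum, map_smul, Basis.coord_apply, smul_eq_mul]
    simp only [h]
    rw [integral_finsetSum _ fun i _ => (hint _ _).mul_const _]
    simp [P, integral_mul_const]
  have hproj : LinearMap.IsProj ρ.invariants P := by
    refine ⟨fun v h => ?_, fun v hv => ?_⟩
    · refine b.ext_elem fun i => ?_
      have h1 := hP (b.coord i ∘ₗ ρ h) v
      have h2 := hP (b.coord i) v
      have h3 := integral_mul_left_eq_self (μ := μ) (fun g => b.coord i (ρ g v)) h
      simp only [LinearMap.comp_apply, map_mul, Module.End.mul_apply, Basis.coord_apply]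
        at h1 h2 h3
      rw [h1, h2, h3]
    · refine b.ext_elem fun i => ?_
      have h2 := hP (b.coord i) v
      simp only [Basis.coord_apply] at h2
      rw [h2]
      have : ∀ g, ρ g v = v := hv
      simp [this]
  rw [← hproj.trace, LinearMap.trace_eq_matrix_trace ℂ b, Matrix.trace]
  simp only [Representation.character, LinearMap.trace_eq_matrix_trace ℂ b, Matrix.trace,
    Matrix.diag_apply, LinearMap.toMatrix_apply]
  refine (integral_finsetSum _ fun i _ => hint (b.coord i) (b i)).trans ?_
  exact Finset.sum_congr rfl fun i _ => (hP (b.coord i) (b i)).symm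

end Representations

/-! ### Summability over partitions -/

theorem hasSum_prod_pi {ι : Type*} {f : ι → ℝ} (hf0 : ∀ i, 0 ≤ f i) (hf : Summable f) (k : ℕ) :
    HasSum (fun L : Fin k → ι => ∏ i, f (L i)) ((∑' i, f i) ^ k) := by
  induction k with
  | zero => simp
  | succ k ih =>
    have hs : Summable fun x : ι × (Fin k → ι) => f x.1 * ∏ i, f (x.2 i) :=
      Summable.mul_of_nonneg (g := fun L : Fin k → ι => ∏ i, f (L i)) hf ih.summable hf0
        fun L => Finset.prod_nonneg fun i _ => hf0 _
    have h := HasSum.mul hf.hasSum ih hs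
    rw [← (Fin.consEquiv fun _ : Fin (k + 1) => ι).hasSum_iff, pow_succ']
    refine (congrArg (fun F => HasSum F _) (funext fun x => ?_)).mpr h
    simp [Fin.consEquiv, Fin.prod_univ_succ]

theorem summable_pow_mul_add_one_pow {q : ℝ} (hq0 : 0 < q) (hq1 : q < 1) (m : ℕ) :
    Summable fun n : ℕ => q ^ n * ((n : ℝ) + 1) ^ m := by
  have h := (summable_nat_add_iff 1).mpr
    (summable_pow_mul_geometric_of_norm_lt_one (r := q) m (by simpa [abs_of_pos hq0] using hq1))
  refine (h.mul_left q⁻¹).congr fun n => ?_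
  push_cast
  rw [pow_succ]
  field_simp

theorem size_add_one_le_prod {N : ℕ} (l : Partn N) :
    (l.size : ℝ) + 1 ≤ ∏ i, ((l.1 i : ℝ) + 1) := by
  have h : ∀ s : Finset (Fin N), ∑ i ∈ s, (l.1 i : ℝ) + 1 ≤ ∏ i ∈ s, ((l.1 i : ℝ) + 1) := by
    intro s
    induction s using Finset.induction_on with
    | empty => simp
    | insert a s ha ih =>
      rw [Finset.sum_insert ha, Finset.prod_insert ha]
      have h0 : (0 : ℝ) ≤ ∑ i ∈ s, (l.1 i : ℝ) := Finset.sum_nonneg fun i _ => Nat.cast_nonneg _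
      have h1 : (0 : ℝ) ≤ l.1 a := Nat.cast_nonneg _
      nlinarith [mul_nonneg h1 h0]
  simpa [Partn.size] using h Finset.univ

theorem summable_pow_size_mul {N : ℕ} {q : ℝ} (hq0 : 0 < q) (hq1 : q < 1) (m : ℕ) :
    Summable fun l : Partn N => q ^ l.size * ((l.size : ℝ) + 1) ^ m := by
  have h := (hasSum_prod_pi (fun n : ℕ => by positivity)
    (summable_pow_mul_add_one_pow hq0 hq1 m) N).summable
  refine Summable.of_nonneg_of_le (fun l => by positivity) (fun l => ?_)
    -- Dominate by the product of $N$ one-variable series, restricted to antitone vectors.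
    (h.comp_injective (Subtype.val_injective (p := fun l : Fin N → ℕ => Antitone l)))
  simp only [Function.comp_apply]
  rw [Finset.prod_mul_distrib, Finset.prod_pow_eq_pow_sum, Finset.prod_pow]
  exact mul_le_mul_of_nonneg_left
    (pow_le_pow_left₀ (by positivity) (size_add_one_le_prod l) m) (by positivity)

/-! ### Polynomial bound on the dimension -/

theorem exists_perm_comp_eq {α β : Type*} [Fintype α] [DecidableEq β] (f f' : α → β)
    (h : ∀ y, Fintype.card {x // f x = y} = Fintype.card {x // f' x = y}) :
    ∃ σ : Equiv.Perm α, ∀ x, f (σ x) = f' x := by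
  let e : (Σ y, {x // f' x = y}) ≃ Σ y, {x // f x = y} :=
    Equiv.sigmaCongrRight fun y => Fintype.equivOfCardEq (h y).symm
  refine ⟨(Equiv.sigmaFiberEquiv f').symm.trans (e.trans (Equiv.sigmaFiberEquiv f)), fun x => ?_⟩
  exact (Fintype.equivOfCardEq (h (f' x)).symm ⟨x, rfl⟩).2

theorem sum_rowPerms_tprod_comp {N : ℕ} (l : Partn N) (x : Cell l → Fin N → ℂ)
    {σ : Equiv.Perm (Cell l)} (hσ : ∀ c, (σ c).1 = c.1) :
    (∑ τ ∈ rowPerms l, permAct l τ) (PiTensorProduct.tprod ℂ fun c => x (σ c)) =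
      (∑ τ ∈ rowPerms l, permAct l τ) (PiTensorProduct.tprod ℂ x) := by
  simp only [LinearMap.sum_apply]
  refine Finset.sum_equiv (Equiv.mulRight σ⁻¹) (fun τ => ?_) (fun τ _ => ?_)
  · simp only [rowPerms, Finset.mem_filter, Finset.mem_univ, true_and, Equiv.coe_mulRight,
      Equiv.Perm.mul_apply]
    have hσ' : ∀ c, (σ⁻¹ c).1 = c.1 := fun c => by simpa using (hσ (σ⁻¹ c)).symm
    refine ⟨fun h c => (h _).trans (hσ' c), fun h c => ?_⟩
    simpa [hσ] using h (σ c)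
  · simp only [permAct, LinearEquiv.coe_coe, PiTensorProduct.reindex_tprod]
    rfl

/-- The image of the Young symmetrizer lies in that of the row symmetrizer `A`. On a basis tensor,
`A` sees only how many cells of row $i$ carry label $j$: $N^2$ counts, each in
$\{0,\dots,|\lambda|\}$. -/
theorem finrank_irrep_le {N : ℕ} (l : Partn N) :
    finrank ℂ (Irrep l) ≤ (l.size + 1) ^ (N * N) := by
  classical
  let A : TensorPow l →ₗ[ℂ] TensorPow l := ∑ σ ∈ rowPerms l, permAct l σ
  let B := Basis.piTensorProduct fun _ : Cell l => Pi.basisFun ℂ (Fin N)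
  have hcell : Fintype.card (Cell l) = l.size := by simp [Partn.size]
  let cnt : (Cell l → Fin N) → Fin N × Fin N → Fin (l.size + 1) := fun p y =>
    ⟨Fintype.card {c : Cell l // (c.1, p c) = y},
      Nat.lt_succ_of_le (hcell ▸ Fintype.card_subtype_le _)⟩
  have hfac : Function.FactorsThrough (fun p => A (B p)) cnt := by
    intro p p' h
    obtain ⟨σ, hσ⟩ := exists_perm_comp_eq (fun c : Cell l => (c.1, p c)) (fun c => (c.1, p' c))
      fun y => congrArg Fin.val (congrFun h y)
    have h1 : ∀ c, (σ c).1 = c.1 := fun c => congrArg Prod.fst (hσ c)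
    have h2 : p' = fun c => p (σ c) := funext fun c => (congrArg Prod.snd (hσ c)).symm
    subst h2
    simp only [B, Basis.piTensorProduct_apply]
    exact (sum_rowPerms_tprod_comp l (fun c => Pi.basisFun ℂ (Fin N) (p c)) h1).symm
  -- Count tables that no labelling realizes get the value 0, which does not affect the span.
  let g : (Fin N × Fin N → Fin (l.size + 1)) → TensorPow l :=
    Function.extend cnt (fun p => A (B p)) 0
  have hle : youngImage l ≤ Submodule.span ℂ (Set.range g) := by
    refine (LinearMap.range_comp_le_range _ A).trans ?_
    rw [LinearMap.range_eq_map, ← B.span_eq, Submodule.map_span_le]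
    rintro _ ⟨p, rfl⟩
    exact Submodule.subset_span ⟨cnt p, hfac.extend_apply 0 p⟩
  calc finrank ℂ (Irrep l) = finrank ℂ (youngImage l) := rfl
    _ ≤ finrank ℂ (Submodule.span ℂ (Set.range g)) := Submodule.finrank_mono hle
    _ ≤ Fintype.card (Fin N × Fin N → Fin (l.size + 1)) := finrank_range_le_card g
    _ = (l.size + 1) ^ (N * N) := by simp

/-! ### Schur characters and the partition function on $U(N)$ -/

instance instIsProbabilityMeasureHaarU (N : ℕ) : IsProbabilityMeasure (haarU N) :=
  ⟨by simpa [haarU] using Measure.haarMeasure_self (G := UN N) (K₀ := ⊤)⟩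

instance instIsMulLeftInvariantHaarU (N : ℕ) : (haarU N).IsMulLeftInvariant :=
  inferInstanceAs (Measure.haarMeasure (G := UN N) ⊤).IsMulLeftInvariant

theorem weaklyContinuous_irrep {N : ℕ} (l : Partn N) : WeaklyContinuous (irrep l) := by
  refine WeaklyContinuous.subrepresentation (ρ := tensorRep l) ?_ _ _
  refine continuous_dual_map_piTensorProduct
    (fun _ (U : UN N) => Matrix.toLin' (U : Matrix (Fin N) (Fin N) ℂ)) fun _ φ v => ?_
  refine (LinearMap.continuous_of_finiteDimensional φ).comp ?_
  simp only [Matrix.toLin'_apply]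
  exact continuous_subtype_val.matrix_mulVec continuous_const

theorem isUnitarizable_irrep {N : ℕ} (l : Partn N) : IsUnitarizable (irrep l) := by
  classical
  refine IsUnitarizable.subrepresentation
    (Basis.piTensorProduct fun _ : Cell l => Pi.basisFun ℂ (Fin N)) (tensorRep l) ?_ _ _
  intro U
  ext p r
  rw [Matrix.conjTranspose_apply, LinearMap.toMatrix_apply, LinearMap.toMatrix_apply]
  simp only [tensorRep, MonoidHom.coe_mk, OneHom.coe_mk, Basis.piTensorProduct_apply,
    PiTensorProduct.map_tprod, Basis.piTensorProduct_repr_tprod_apply, Pi.basisFun_repr,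
    Pi.basisFun_apply, Matrix.toLin'_apply, Matrix.mulVec_single_one, star_prod]
  rfl

theorem continuous_schurChar {N : ℕ} (l : Partn N) : Continuous (schurChar l) := by
  change Continuous fun U => LinearMap.trace ℂ (Irrep l) (irrep l U)
  let b := finBasis ℂ (Irrep l)
  simp only [LinearMap.trace_eq_matrix_trace ℂ b, Matrix.trace,
    Matrix.diag_apply, LinearMap.toMatrix_apply]
  exact continuous_finsetSum _ fun i _ => weaklyContinuous_irrep l (b.coord i) (b i)

theorem continuous_partitionTerm {N : ℕ} (q : ℝ) (l : Partn N) :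
    Continuous fun U => partitionTerm q U l :=
  continuous_const.mul ((continuous_schurChar l).norm.pow 2)

theorem partitionTerm_nonneg {N : ℕ} {q : ℝ} (hq0 : 0 < q) (U : UN N) (l : Partn N) :
    0 ≤ partitionTerm q U l := by
  unfold partitionTerm
  positivity

theorem partitionTerm_le {N : ℕ} {q : ℝ} (hq0 : 0 < q) (U : UN N) (l : Partn N) :
    partitionTerm q U l ≤ q ^ l.size * ((l.size : ℝ) + 1) ^ (N * N * 2) := by
  have h : ‖schurChar l U‖ ≤ ((l.size : ℝ) + 1) ^ (N * N) :=
    ((isUnitarizable_irrep l).norm_character_le U).trans (by exact_mod_cast finrank_irrep_le l)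
  rw [partitionTerm, pow_mul]
  gcongr

theorem summable_partitionTerm {N : ℕ} {q : ℝ} (hq0 : 0 < q) (hq1 : q < 1) (U : UN N) :
    Summable (partitionTerm q U) :=
  Summable.of_nonneg_of_le (partitionTerm_nonneg hq0 U) (partitionTerm_le hq0 U)
    (summable_pow_size_mul hq0 hq1 _)

theorem continuous_partitionFn {N : ℕ} {q : ℝ} (hq0 : 0 < q) (hq1 : q < 1) :
    Continuous (partitionFn (N := N) q) := by
  refine continuous_tsum (continuous_partitionTerm q)
    (summable_pow_size_mul hq0 hq1 (N * N * 2)) fun l U => ?_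
  rw [Real.norm_of_nonneg (partitionTerm_nonneg hq0 U l)]
  exact partitionTerm_le hq0 U l

theorem character_adjointTensorRep {N k : ℕ} (L : Fin k → Partn N) (U : UN N) :
    (adjointTensorRep L).character U = ((∏ i, ‖schurChar (L i) U‖ ^ 2 : ℝ) : ℂ) := by
  refine (trace_map_piTensorProduct fun i => adjointRep (L i) U).trans ?_
  push_cast
  refine Finset.prod_congr rfl fun i _ => ?_
  refine (Representation.char_linHom (irrep (L i)) (irrep (L i)) U).trans ?_
  rw [(isUnitarizable_irrep (L i)).character_inv, ← Complex.conj_mul']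
  rfl

/-! ### Moments -/

theorem integral_prod_norm_schurChar_sq {N k : ℕ} (L : Fin k → Partn N) :
    ∫ U, ∏ i, ‖schurChar (L i) U‖ ^ 2 ∂(haarU N) = invDim L := by
  have hw : WeaklyContinuous (adjointTensorRep L) :=
    continuous_dual_map_piTensorProduct (fun i U => adjointRep (L i) U)
      fun i => (weaklyContinuous_irrep (L i)).linHom
  have h := hw.integral_character (haarU N)
  simp only [character_adjointTensorRep] at h
  rw [integral_complex_ofReal] at h
  exact_mod_cast h

theorem integral_prod_partitionTerm {N k : ℕ} (q : ℝ) (L : Fin k → Partn N) :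
    ∫ U, ∏ i, partitionTerm q U (L i) ∂(haarU N) = q ^ (∑ i, (L i).size) * (invDim L : ℝ) := by
  simp only [partitionTerm, Finset.prod_mul_distrib, Finset.prod_pow_eq_pow_sum,
    integral_const_mul, integral_prod_norm_schurChar_sq]

theorem integrable_of_continuous {N : ℕ} {f : UN N → ℝ} (hf : Continuous f) :
    Integrable f (haarU N) :=
  hf.integrable_of_hasCompactSupport (HasCompactSupport.of_compactSpace _)

theorem hasSum_integral_partitionFn_pow {N : ℕ} (k : ℕ) {q : ℝ} (hq0 : 0 < q) (hq1 : q < 1) :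
    HasSum (fun L : Fin k → Partn N => q ^ (∑ i, (L i).size) * (invDim L : ℝ))
      (∫ U : UN N, partitionFn q U ^ k ∂(haarU N)) := by
  have hint : ∀ L : Fin k → Partn N,
      Integrable (fun U => ∏ i, partitionTerm q U (L i)) (haarU N) := fun L =>
    integrable_of_continuous (continuous_finsetProd _ fun i _ => continuous_partitionTerm q (L i))
  have hnonneg : ∀ (L : Fin k → Partn N) (U : UN N), 0 ≤ ∏ i, partitionTerm q U (L i) :=
    fun L U => Finset.prod_nonneg fun i _ => partitionTerm_nonneg hq0 U (L i)
  have hsum := (hasSum_prod_pi (fun l : Partn N => by positivity)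
    (summable_pow_size_mul hq0 hq1 (N * N * 2)) k).summable
  have hnorm : Summable fun L : Fin k → Partn N =>
      ∫ U, ‖∏ i, partitionTerm q U (L i)‖ ∂(haarU N) := by
    refine Summable.of_nonneg_of_le (fun L => integral_nonneg fun U => norm_nonneg _)
      (fun L => ?_) hsum
    refine (integral_mono (hint L).norm (integrable_const _) fun U => ?_).trans
      (by rw [integral_const, probReal_univ, one_smul])
    rw [Real.norm_of_nonneg (hnonneg L U)]
    exact Finset.prod_le_prod (fun i _ => partitionTerm_nonneg hq0 U (L i))
      fun i _ => partitionTerm_le hq0 U (L i)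
  -- The pointwise bound does not depend on $U$ and the Haar measure has mass 1, so the integrals of
  -- the norms are summable over tuples.
  have h := hasSum_integral_of_summable_integral_norm hint hnorm
  simp only [integral_prod_partitionTerm] at h
  have hZ : ∀ U : UN N, ∑' L : Fin k → Partn N, ∏ i, partitionTerm q U (L i) =
      partitionFn q U ^ k := fun U => (hasSum_prod_pi (partitionTerm_nonneg hq0 U)
    (summable_partitionTerm hq0 hq1 U) k).tsum_eq
  simpa only [hZ] using h

end SchurCUE

theorem mainTheorem8 (N k : ℕ) (q : ℝ) (hq0 : 0 < q) (hq1 : q < 1) :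
    (∀ U : SchurCUE.UN N, Summable (SchurCUE.partitionTerm q U)) ∧
    MeasureTheory.Integrable (fun U : SchurCUE.UN N => SchurCUE.partitionFn q U ^ k)
      (SchurCUE.haarU N) ∧
    HasSum
      (fun L : Fin k → SchurCUE.Partn N =>
        q ^ (∑ i, (L i).size) * (SchurCUE.invDim L : ℝ))
      (∫ U : SchurCUE.UN N, SchurCUE.partitionFn q U ^ k ∂(SchurCUE.haarU N)) :=
  ⟨SchurCUE.summable_partitionTerm hq0 hq1,
    SchurCUE.integrable_of_continuous ((SchurCUE.continuous_partitionFn hq0 hq1).pow k),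
    SchurCUE.hasSum_integral_partitionFn_pow k hq0 hq1⟩
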